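/- Let $\Omega\subset\mathbb{R}^2$ be a bounded domain (a bounded, non-empty, connected open set), and let $u:\overline{\Omega}\to\mathbb{R}$ be continuous on $\overline{\Omega}$, harmonic in $\Omega$, and not constant on $\Omega$. Let $Max_u$ be the set of all $x\in\partial\Omega$ that have a neighbourhood $U$ with $u(x)\ge u(y)$ for all $y\in U\cap\overline{\Omega}$, and let $Min_u$ be the set of all $x\in\partial\Omega$ that have a neighbourhood $U$ with $u(x)\le u(y)$ for all $y\in U\cap\overline{\Omega}$. If $Max_u$ and $Min_u$ each have exactly one connected component, then $u$ has no critical points in $\Omega$, that is, $C(u):=\{x\in\Omega : \nabla u(x)=0\}=\emptyset$. -/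

import Mathlib

/-- The critical set of a real function on a subset `Ω` of the plane: the points of `Ω` at which
its gradient vanishes. The plane is `ℂ` with its structure of a real Euclidean space. -/
noncomputable def criticalSet (Ω : Set ℂ) (u : ℂ → ℝ) : Set ℂ :=
  {z | z ∈ Ω ∧ gradient u z = 0}

/-- The boundary points `z` of `Ω` with `u w ≤ u z` for all points `w` of the closure of `Ω`
in a neighbourhood of `z`. -/
def boundaryMaxSet (Ω : Set ℂ) (u : ℂ → ℝ) : Set ℂ :=
  {z | z ∈ frontier Ω ∧ IsLocalMaxOn u (closure Ω) z}

/-- The boundary points `z` of `Ω` with `u z ≤ u w` for all points `w` of the closure of `Ω`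
in a neighbourhood of `z`. -/
def boundaryMinSet (Ω : Set ℂ) (u : ℂ → ℝ) : Set ℂ :=
  {z | z ∈ frontier Ω ∧ IsLocalMinOn u (closure Ω) z}

/-- The number of connected components of a set of the plane (zero for the empty set, `⊤` if there
are infinitely many). -/
noncomputable def numComponents (S : Set ℂ) : ℕ∞ :=
  ENat.card (ConnectedComponents S)

open Set Filter Topology

/-! By the maximum principle every local maximum of `u` on the closure lies on the boundary. The
values at local maxima form a countable set, so `u` is constant on a connected set of them. If a
superlevel set split into two closed pieces, each piece would contain a local maximum, and the split
would disconnect the set of maxima. Hence all superlevel sets are connected, and all sublevel sets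
too, by passing to `-u`.

At a critical point `z`, `u - u z` behaves like the real part of `a (w - z) ^ n` with `n ≥ 2`, so at
least four rays from `z` alternate in sign. For small `ε`, the connected sets `u ≥ u z + ε` and `u ≤
u z - ε` then join interlaced pairs of directions while staying disjoint. The plane forbids this
(`not_interlaced_of_disjoint_of_isPreconnected`): a logarithm would have two increments differing by
`2πi`. -/

/-! ### Connectedness of superlevel sets -/

theorem IsPreconnected.subsingleton_image_of_countable {X Y : Type*} [TopologicalSpace X]
    [MetricSpace Y] {s : Set X} (hs : IsPreconnected s) {f : X → Y} (hf : ContinuousOn f s)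
    (hc : (f '' s).Countable) : (f '' s).Subsingleton :=
  hc.isTotallyDisconnected _ Subset.rfl (hs.image f hf)

/-- Each such value is the supremum of `f` over the trace on `E` of a member of a countable basis.
-/
theorem countable_image_isLocalMaxOn {X : Type*} [TopologicalSpace X]
    [SecondCountableTopology X] (f : X → ℝ) (E : Set X) :
    (f '' {x | x ∈ E ∧ IsLocalMaxOn f E x}).Countable := by
  have hB := TopologicalSpace.isBasis_countableBasis X
  have key : ∀ x, x ∈ E → IsLocalMaxOn f E x →
      ∃ b ∈ TopologicalSpace.countableBasis X, x ∈ b ∧ ∀ y ∈ b ∩ E, f y ≤ f x := by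
    intro x _ hx
    obtain ⟨U, hU, h⟩ := mem_nhdsWithin_iff_exists_mem_nhds_inter.1 hx
    obtain ⟨b, hb, hxb, hbU⟩ := hB.mem_nhds_iff.1 hU
    exact ⟨b, hb, hxb, fun y hy => h ⟨hbU hy.1, hy.2⟩⟩
  refine ((TopologicalSpace.countable_countableBasis X).image
    (fun b => sSup (f '' (b ∩ E)))).mono ?_
  rintro _ ⟨x, ⟨hxE, hx⟩, rfl⟩
  obtain ⟨b, hb, hxb, h⟩ := key x hxE hx
  refine ⟨b, hb, ?_⟩
  refine IsGreatest.csSup_eq ⟨⟨x, ⟨hxb, hxE⟩, rfl⟩, ?_⟩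
  rintro _ ⟨y, hy, rfl⟩
  exact h y hy

theorem isPreconnected_superlevel_of_isPreconnected_isLocalMaxOn {X : Type*} [TopologicalSpace X]
    [T2Space X] [SecondCountableTopology X] {f : X → ℝ} {E : Set X} (hE : IsCompact E)
    (hf : ContinuousOn f E) (hM : IsPreconnected {x | x ∈ E ∧ IsLocalMaxOn f E x}) (c : ℝ) :
    IsPreconnected {x | x ∈ E ∧ c ≤ f x} := by
  set M := {x | x ∈ E ∧ IsLocalMaxOn f E x}
  set s := {x | x ∈ E ∧ c ≤ f x}
  have hsE : s ⊆ E := fun x hx => hx.1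
  have hsc : IsCompact s := by
    have : IsClosed s := hf.preimage_isClosed_of_isClosed hE.isClosed isClosed_Ici
    exact hE.of_isClosed_subset this hsE
  have hconst : ∀ x ∈ M, ∀ y ∈ M, f x = f y := fun x hx y hy =>
    hM.subsingleton_image_of_countable (hf.mono fun x hx => hx.1)
      (countable_image_isLocalMaxOn f E) ⟨x, hx, rfl⟩ ⟨y, hy, rfl⟩
  -- The maximum over one piece is a local maximum on `E`: nearby points avoid the other piece, and
  -- points outside `s` have values below `c`.
  have piece : ∀ v v' : Set X, IsClosed v → IsClosed v' → s ⊆ v ∪ v' → s ∩ (v ∩ v') = ∅ →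
      (s ∩ v).Nonempty → ∃ y ∈ M, y ∈ s ∩ v := by
    intro v v' hv hv' hcov hdis hne
    obtain ⟨y, hy, hmax⟩ := (hsc.inter_right hv).exists_isMaxOn hne
      (hf.mono (inter_subset_left.trans hsE))
    refine ⟨y, ⟨hy.1.1, ?_⟩, hy⟩
    have hyv' : y ∈ v'ᶜ := fun h => (eq_empty_iff_forall_notMem.1 hdis y) ⟨hy.1, hy.2, h⟩
    filter_upwards [mem_nhdsWithin_of_mem_nhds (hv'.isOpen_compl.mem_nhds hyv'),
      self_mem_nhdsWithin] with w hw hwE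
    by_cases hcw : c ≤ f w
    · exact hmax ⟨⟨hwE, hcw⟩, (hcov ⟨hwE, hcw⟩).resolve_right hw⟩
    · exact (not_le.1 hcw).le.trans hy.1.2
  rw [isPreconnected_closed_iff]
  intro v v' hv hv' hcov h1 h2
  by_contra hne
  have hdis := not_nonempty_iff_eq_empty.1 hne
  obtain ⟨y, hyM, hy⟩ := piece v v' hv hv' hcov hdis h1
  obtain ⟨y', hyM', hy'⟩ := piece v' v hv' hv (by rwa [union_comm]) (by rwa [inter_comm v' v]) h2
  have hMs : M ⊆ s := fun x hx => ⟨hx.1, hconst y hyM x hx ▸ hy.1.2⟩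
  obtain ⟨x, hx, hxv⟩ := isPreconnected_closed_iff.1 hM v v' hv hv' (hMs.trans hcov)
    ⟨y, hyM, hy.2⟩ ⟨y', hyM', hy'.2⟩
  exact hne ⟨x, hMs hx, hxv⟩

theorem isPreconnected_of_numComponents_eq_one {S : Set ℂ} (h : numComponents S = 1) :
    IsPreconnected S := by
  rw [numComponents, ENat.card_eq_one_iff_unique] at h
  obtain ⟨h⟩ := h
  rw [isPreconnected_iff_preconnectedSpace]
  exact preconnectedSpace_iff_connectedComponent.2 fun x => by
    ext y
    simp only [mem_univ, iff_true]
    exact ConnectedComponents.coe_eq_coe'.1 (Subsingleton.elim (y : ConnectedComponents S) x)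

/-! ### Continuous logarithms and interlaced connected sets -/

/-- The difference `F - G` takes values in a single coset of `2πiℤ`, which is countable. -/
theorem IsPreconnected.sub_eq_sub_of_exp_eq_mul_exp {X : Type*} [TopologicalSpace X] {S : Set X}
    (hS : IsPreconnected S) {F G : X → ℂ} (hF : ContinuousOn F S) (hG : ContinuousOn G S) {k : ℂ}
    (h : ∀ w ∈ S, Complex.exp (F w) = k * Complex.exp (G w)) {x y : X} (hx : x ∈ S) (hy : y ∈ S) :
    F x - G x = F y - G y := by
  have hk : ∀ w ∈ S, Complex.exp (F w - G w) = k := fun w hw => by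
    rw [Complex.exp_sub, h w hw, mul_div_cancel_right₀ _ (Complex.exp_ne_zero _)]
  refine hS.subsingleton_image_of_countable (f := fun w => F w - G w) (hF.sub hG) ?_
    ⟨x, hx, rfl⟩ ⟨y, hy, rfl⟩
  refine (countable_range fun n : ℤ => F x - G x + n * (2 * Real.pi * Complex.I)).mono ?_
  rintro _ ⟨w, hw, rfl⟩
  obtain ⟨n, hn⟩ := Complex.exp_eq_exp_iff_exists_int.1 ((hk w hw).trans (hk x hx).symm)
  exact ⟨n, hn.symm⟩

/-- If `p` and `q` lie in a connected set disjoint from the compact set `K`, then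
`(w - p) / (w - q)` has a continuous logarithm on `K`. -/
theorem IsPreconnected.exists_continuousOn_log_div {K N : Set ℂ} (hK : IsCompact K)
    (hN : IsPreconnected N) (hKN : Disjoint K N) {p q : ℂ} (hp : p ∈ N) (hq : q ∈ N) :
    ∃ F : ℂ → ℂ, ContinuousOn F K ∧ ∀ w ∈ K, Complex.exp (F w) = (w - p) / (w - q) := by
  have hne : ∀ w ∈ K, ∀ p ∈ N, w - p ≠ 0 := fun w hw p hp h =>
    disjoint_left.1 hKN hw (sub_eq_zero.1 h ▸ hp)
  refine hN.induction₂ (fun p q => ∃ F : ℂ → ℂ, ContinuousOn F K ∧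
    ∀ w ∈ K, Complex.exp (F w) = (w - p) / (w - q)) ?_ ?_ ?_ hp hq
  -- For `q` close to `p` the quotient is within distance 1 of 1 on `K`, so the principal logarithm
  -- serves.
  · intro p hp
    have hpK : Kᶜ ∈ 𝓝 p := hK.isClosed.isOpen_compl.mem_nhds (disjoint_right.1 hKN hp)
    obtain ⟨ε, hε, hball⟩ := Metric.mem_nhds_iff.1 hpK
    filter_upwards [mem_nhdsWithin_of_mem_nhds (Metric.ball_mem_nhds p (half_pos hε)),
      self_mem_nhdsWithin] with q hq hqN
    have hq' : ‖q - p‖ < ε / 2 := by simpa [dist_eq_norm] using hq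
    have hslit : ∀ w ∈ K, (w - p) / (w - q) ∈ Complex.slitPlane := by
      intro w hw
      have h1 : ε ≤ ‖w - p‖ := by
        by_contra hlt
        exact hball (by simpa [dist_eq_norm] using hlt) hw
      have h2 : ‖w - p‖ ≤ ‖w - q‖ + ‖q - p‖ := by
        simpa using norm_add_le (w - q) (q - p)
      have h3 : (w - p) / (w - q) = 1 + (q - p) / (w - q) := by
        field_simp [hne w hw q hqN]; ring
      rw [h3]
      refine Complex.mem_slitPlane_of_norm_lt_one ?_
      rw [norm_div, div_lt_one (by linarith)]
      linarith
    refine ⟨fun w => Complex.log ((w - p) / (w - q)), ContinuousOn.clog ?_ hslit, fun w hw =>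
      Complex.exp_log (Complex.slitPlane_ne_zero (hslit w hw))⟩
    exact ContinuousOn.div (by fun_prop) (by fun_prop) fun w hw => hne w hw q hqN
  · rintro p q s hp hq hs ⟨F, hF, hF'⟩ ⟨G, hG, hG'⟩
    refine ⟨fun w => F w + G w, hF.add hG, fun w hw => ?_⟩
    rw [Complex.exp_add, hF' w hw, hG' w hw, div_mul_div_cancel₀ (hne w hw q hq)]
  · rintro p q hp hq ⟨F, hF, hF'⟩
    refine ⟨fun w => -F w, hF.neg, fun w hw => ?_⟩
    rw [Complex.exp_neg, hF' w hw, inv_div]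

/-- Halving the angle gives modulus `2 sin (θ / 2)` and argument `(θ - π) / 2`, which the range of
`θ` keeps in the principal branch. -/
theorem Complex.log_one_sub_exp_mul_I {θ : ℝ} (h0 : 0 < θ) (h1 : θ < 2 * Real.pi) :
    Complex.log (1 - Complex.exp (θ * Complex.I)) =
      Real.log (2 * Real.sin (θ / 2)) + ((θ - Real.pi) / 2 : ℝ) * Complex.I := by
  have hs : 0 < Real.sin (θ / 2) := Real.sin_pos_of_pos_of_lt_pi (by linarith) (by linarith)
  have h : 1 - Complex.exp (θ * Complex.I) = ((2 * Real.sin (θ / 2) : ℝ) : ℂ) *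
      Complex.exp (((θ - Real.pi) / 2 : ℝ) * Complex.I) := by
    have e1 : (((θ - Real.pi) / 2 : ℝ) : ℂ) * Complex.I =
        (θ / 2 : ℝ) * Complex.I + -(Real.pi / 2 * Complex.I) := by push_cast; ring
    have e2 : (θ : ℂ) * Complex.I = (θ / 2 : ℝ) * Complex.I + (θ / 2 : ℝ) * Complex.I := by
      push_cast; ring
    rw [e1, e2, Complex.exp_add, Complex.exp_add, Complex.exp_neg, Complex.exp_pi_div_two_mul_I,
      Complex.inv_I, Complex.exp_mul_I, ← Complex.ofReal_cos, ← Complex.ofReal_sin]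
    have hcs : ((Real.cos (θ / 2) : ℝ) : ℂ) ^ 2 = 1 - (Real.sin (θ / 2) : ℝ) ^ 2 := by
      rw [← Complex.ofReal_pow, Real.cos_sq']; push_cast; ring
    rw [Complex.ofReal_mul, Complex.ofReal_ofNat]
    generalize ((Real.cos (θ / 2) : ℝ) : ℂ) = c at hcs ⊢
    generalize ((Real.sin (θ / 2) : ℝ) : ℂ) = s at hcs ⊢
    linear_combination -hcs + s ^ 2 * Complex.I_sq
  rw [h, Complex.log_ofReal_mul (by positivity) (Complex.exp_ne_zero _), Complex.log_exp]
  · simp; linarith [Real.pi_pos]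
  · simp; linarith [Real.pi_pos]

theorem Complex.log_one_sub_exp_sub_log_one_sub_exp_neg {θ : ℝ} (h0 : 0 < θ)
    (h1 : θ < 2 * Real.pi) :
    Complex.log (1 - Complex.exp (θ * Complex.I)) -
      Complex.log (1 - Complex.exp ((-θ : ℝ) * Complex.I)) = (θ - Real.pi) * Complex.I := by
  have h2 : Complex.exp ((-θ : ℝ) * Complex.I) =
      Complex.exp ((2 * Real.pi - θ : ℝ) * Complex.I) := by
    rw [Complex.exp_eq_exp_iff_exists_int]
    exact ⟨-1, by push_cast; ring⟩
  have h3 : Real.sin ((2 * Real.pi - θ) / 2) = Real.sin (θ / 2) := by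
    rw [← Real.sin_pi_sub (θ / 2)]; congr 1; ring
  rw [h2, Complex.log_one_sub_exp_mul_I h0 h1,
    Complex.log_one_sub_exp_mul_I (by linarith) (by linarith), h3]
  push_cast; ring

theorem Complex.one_sub_mem_slitPlane {s : ℂ} (h : ∀ t : ℝ, 1 ≤ t → s ≠ t) :
    1 - s ∈ Complex.slitPlane := by
  rw [Complex.mem_slitPlane_iff]
  by_contra! hc
  refine h s.re (by have := hc.1; simp at this; linarith) ?_
  apply Complex.ext
  · simp
  · have := hc.2; simp at this; simpa using this

/-- Two disjoint connected sets cannot join two interlaced pairs of directions at a point `z`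
without crossing the radii of one another. -/
theorem not_interlaced_of_disjoint_of_isPreconnected {P N : Set ℂ} (hPc : IsCompact P)
    (hP : IsPreconnected P) (hN : IsPreconnected N) (hPN : Disjoint P N) {z : ℂ} {r : ℝ}
    (hr : 0 < r) {α₁ α₂ α₃ α₄ : ℝ} (h12 : α₁ < α₂) (h23 : α₂ < α₃) (h34 : α₃ < α₄)
    (h41 : α₄ < α₁ + 2 * Real.pi)
    (h1 : z + r * Complex.exp (α₁ * Complex.I) ∈ P) (h3 : z + r * Complex.exp (α₃ * Complex.I) ∈ P)
    (h2 : z + r * Complex.exp (α₂ * Complex.I) ∈ N) (h4 : z + r * Complex.exp (α₄ * Complex.I) ∈ N)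
    (hN1 : ∀ t : ℝ, 0 ≤ t → t ≤ r → z + t * Complex.exp (α₁ * Complex.I) ∉ N)
    (hN3 : ∀ t : ℝ, 0 ≤ t → t ≤ r → z + t * Complex.exp (α₃ * Complex.I) ∉ N)
    (hP2 : ∀ t : ℝ, 0 ≤ t → t ≤ r → z + t * Complex.exp (α₂ * Complex.I) ∉ P)
    (hP4 : ∀ t : ℝ, 0 ≤ t → t ≤ r → z + t * Complex.exp (α₄ * Complex.I) ∉ P) : False := by
  set ray : ℝ → Set ℂ := fun α => (fun t : ℝ => z + t * Complex.exp (α * Complex.I)) '' Icc 0 r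
  have hrc : ∀ α, IsCompact (ray α) := fun α => isCompact_Icc.image (by fun_prop)
  have hrp : ∀ α, IsPreconnected (ray α) := fun α =>
    isPreconnected_Icc.image _ (by fun_prop)
  have hz : ∀ α, z ∈ ray α := fun α => ⟨0, ⟨le_rfl, hr.le⟩, by simp⟩
  have hend : ∀ α, z + r * Complex.exp (α * Complex.I) ∈ ray α := fun α =>
    ⟨r, ⟨hr.le, le_rfl⟩, rfl⟩
  have hrayN : ∀ w ∈ ray α₁ ∪ ray α₃, w ∉ N := by
    rintro w (⟨t, ht, rfl⟩ | ⟨t, ht, rfl⟩)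
    exacts [hN1 t ht.1 ht.2, hN3 t ht.1 ht.2]
  have hKN : Disjoint (P ∪ (ray α₁ ∪ ray α₃)) N :=
    hPN.union_left (disjoint_left.2 hrayN)
  -- The increment of `F` between the two endpoints in `P` is computed twice, across `P` and along
  -- the radii through `z`.
  obtain ⟨F, hFc, hF⟩ := hN.exists_continuousOn_log_div
    (hPc.union ((hrc α₁).union (hrc α₃))) hKN h2 h4
  set e : ℝ → ℂ := fun α => Complex.exp (α * Complex.I) with he
  have hr0 : (r : ℂ) ≠ 0 := by exact_mod_cast hr.ne'
  have he0 : ∀ α, e α ≠ 0 := fun α => Complex.exp_ne_zero _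
  have hen : ∀ α, ‖e α‖ = 1 := fun α => Complex.norm_exp_ofReal_mul_I α
  have hedist : ∀ α β, e α / e β = Complex.exp ((α - β : ℝ) * Complex.I) := fun α β => by
    simp only [he]; rw [← Complex.exp_sub]; congr 1; push_cast; ring
  -- the logarithm on `P` computed along the radii to `N`
  have hPz : ∀ w ∈ P, w - z ≠ 0 := fun w hw h => by
    rw [sub_eq_zero.1 h] at hw
    exact hP2 0 le_rfl hr.le (by simpa using hw)
  have slitP : ∀ α, (∀ t : ℝ, 0 ≤ t → t ≤ r → z + t * e α ∉ P) → ∀ w ∈ P,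
      1 - r * e α / (w - z) ∈ Complex.slitPlane := by
    intro α hα w hw
    refine Complex.one_sub_mem_slitPlane fun t ht h => hα (r / t) (by positivity)
      (div_le_self hr.le ht) ?_
    have ht0 : (t : ℂ) ≠ 0 := by exact_mod_cast (by linarith : t ≠ 0)
    have : z + ((r / t : ℝ) : ℂ) * e α = w := by
      rw [div_eq_iff (hPz w hw)] at h
      push_cast
      field_simp
      linear_combination h
    rwa [this]
  have hGc : ∀ α, (∀ t : ℝ, 0 ≤ t → t ≤ r → z + t * e α ∉ P) →
      ContinuousOn (fun w => Complex.log (1 - r * e α / (w - z))) P := fun α hα =>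
    ContinuousOn.clog (continuousOn_const.sub (ContinuousOn.div (by fun_prop) (by fun_prop) hPz))
      (slitP α hα)
  have hP := hP.sub_eq_sub_of_exp_eq_mul_exp (k := 1) (hFc.mono subset_union_left)
    ((hGc α₂ hP2).sub (hGc α₄ hP4)) (fun w hw => by
      have hw0 := hPz w hw
      have hb := Complex.slitPlane_ne_zero (slitP α₄ hP4 w hw)
      have hb' : w - (z + r * e α₄) ≠ 0 := fun h => hb (by
        rw [sub_eq_zero, eq_comm, div_eq_one_iff_eq hw0]; linear_combination -h)
      rw [hF w (Or.inl hw), Pi.sub_apply, Complex.exp_sub,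
        Complex.exp_log (Complex.slitPlane_ne_zero (slitP α₂ hP2 w hw)), Complex.exp_log hb,
        one_mul, div_eq_div_iff hb' hb]
      simp only [he]
      field_simp
      ring) h3 h1
  -- the logarithm on the radii to `P`
  have slitR : ∀ β, z + r * e β ∈ N → ∀ w ∈ ray α₁ ∪ ray α₃,
      1 - (w - z) / (r * e β) ∈ Complex.slitPlane := by
    intro β hβ w hw
    refine Complex.one_sub_mem_slitPlane fun t ht h => hrayN w hw ?_
    rw [div_eq_iff (mul_ne_zero hr0 (he0 β))] at h
    have hle : ‖w - z‖ ≤ r := by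
      rcases hw with ⟨τ, hτ, rfl⟩ | ⟨τ, hτ, rfl⟩ <;>
      · simp only [add_sub_cancel_left, norm_mul, Complex.norm_exp_ofReal_mul_I, mul_one,
          Complex.norm_real, Real.norm_eq_abs]
        rw [abs_of_nonneg hτ.1]; exact hτ.2
    have ht1 : t = 1 := by
      rw [h, norm_mul, norm_mul, hen, Complex.norm_real, Complex.norm_real, Real.norm_eq_abs,
        Real.norm_eq_abs, abs_of_pos hr, abs_of_pos (by linarith)] at hle
      nlinarith
    have : w = z + r * e β := by
      rw [ht1] at h; push_cast at h; linear_combination h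
    rwa [this]
  have hHc : ∀ β, z + r * e β ∈ N →
      ContinuousOn (fun w => Complex.log (1 - (w - z) / (r * e β))) (ray α₁ ∪ ray α₃) :=
    fun β hβ => ContinuousOn.clog (by fun_prop) (slitR β hβ)
  have hR := ((hrp α₁).union z (hz _) (hz _) (hrp α₃)).sub_eq_sub_of_exp_eq_mul_exp
    (k := e α₂ / e α₄) (hFc.mono subset_union_right) ((hHc α₂ h2).sub (hHc α₄ h4))
    (fun w hw => by
      have hb := Complex.slitPlane_ne_zero (slitR α₄ h4 w hw)
      have h02 := mul_ne_zero hr0 (he0 α₂)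
      have h04 := mul_ne_zero hr0 (he0 α₄)
      have hb' : w - (z + r * e α₄) ≠ 0 := fun h => hb (by
        rw [sub_eq_zero, eq_comm, div_eq_one_iff_eq h04]; linear_combination h)
      have hb'' : r * e α₄ - (w - z) ≠ 0 := fun h => hb' (by linear_combination -h)
      rw [hF w (Or.inr hw), Pi.sub_apply, Complex.exp_sub,
        Complex.exp_log (Complex.slitPlane_ne_zero (slitR α₂ h2 w hw)), Complex.exp_log hb,
        one_sub_div h02, one_sub_div h04]
      change (w - (z + r * e α₂)) / (w - (z + r * e α₄)) = _
      have := he0 α₂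
      have := he0 α₄
      field_simp
      ring) (Or.inr (hend α₃)) (Or.inl (hend α₁))
  have hq : ∀ α β : ℝ, r * e α / (r * e β) = Complex.exp ((α - β : ℝ) * Complex.I) := fun α β => by
    rw [mul_div_mul_left _ _ hr0, hedist]
  simp only [Pi.sub_apply, add_sub_cancel_left] at hP hR
  change _ - (Complex.log (1 - r * e α₂ / (r * e α₃)) - Complex.log (1 - r * e α₄ / (r * e α₃))) =
    _ - (Complex.log (1 - r * e α₂ / (r * e α₁)) - Complex.log (1 - r * e α₄ / (r * e α₁))) at hP
  change _ - (Complex.log (1 - r * e α₃ / (r * e α₂)) - Complex.log (1 - r * e α₃ / (r * e α₄))) =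
    _ - (Complex.log (1 - r * e α₁ / (r * e α₂)) - Complex.log (1 - r * e α₁ / (r * e α₄))) at hR
  simp only [hq] at hP hR
  have k := fun (α β : ℝ) (h : α < β) (h' : β < α + 2 * Real.pi) =>
    Complex.log_one_sub_exp_sub_log_one_sub_exp_neg (θ := β - α) (by linarith) (by linarith)
  simp only [neg_sub] at k
  have k32 := k α₂ α₃ h23 (by linarith)
  have k43 := k α₃ α₄ h34 (by linarith)
  have k21 := k α₁ α₂ h12 (by linarith)
  have k41 := k α₁ α₄ (by linarith) h41
  -- The angles cancel; interlacing makes three of the terms `-π` and one `+π`, so a full turn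
  -- remains.
  have : (2 * Real.pi * Complex.I : ℂ) = 0 := by
    push_cast at hP hR k32 k43 k21 k41
    linear_combination hR - hP + k32 + k43 + k21 - k41
  exact Complex.two_pi_I_ne_zero this

/-! ### Local behaviour of harmonic functions -/

theorem InnerProductSpace.HarmonicAt.exists_analyticAt_re_eventuallyEq {u : ℂ → ℝ} {z : ℂ}
    (h : InnerProductSpace.HarmonicAt u z) :
    ∃ F : ℂ → ℂ, AnalyticAt ℂ F z ∧ u =ᶠ[𝓝 z] fun w => (F w).re := by
  obtain ⟨ε, hε, hball⟩ := Metric.isOpen_iff.1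
    (InnerProductSpace.isOpen_setOfPred_harmonicAt u) z h
  obtain ⟨F, hF, hFu⟩ := InnerProductSpace.HarmonicOnNhd.exists_analyticOnNhd_ball_re_eq
    (fun _ hy => hball hy)
  exact ⟨F, hF z (Metric.mem_ball_self hε),
    eventually_of_mem (Metric.ball_mem_nhds z hε) fun y hy => (hFu hy).symm⟩

/-- Since `exp u` is the modulus of the holomorphic `exp F`, the maximum modulus principle applies.
-/
theorem InnerProductSpace.HarmonicAt.eventually_eq_of_isLocalMax {u : ℂ → ℝ} {z : ℂ}
    (h : InnerProductSpace.HarmonicAt u z) (hz : IsLocalMax u z) : ∀ᶠ w in 𝓝 z, u w = u z := by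
  obtain ⟨F, hF, hFu⟩ := h.exists_analyticAt_re_eventuallyEq
  have hd : ∀ᶠ w in 𝓝 z, DifferentiableAt ℂ (fun w => Complex.exp (F w)) w :=
    hF.eventually_analyticAt.mono fun w hw => hw.differentiableAt.cexp
  have hm : IsLocalMax (norm ∘ fun w => Complex.exp (F w)) z := by
    filter_upwards [hz, hFu] with w hw hw'
    simp only [Function.comp_apply, Complex.norm_exp, Real.exp_le_exp]
    rw [← hw']
    exact hw.trans_eq hFu.self_of_nhds
  filter_upwards [Complex.norm_eventually_eq_of_isLocalMax hd hm, hFu] with w hw hw'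
  rw [Complex.norm_exp, Complex.norm_exp, Real.exp_eq_exp] at hw
  rw [hw', hFu.self_of_nhds, hw]

theorem InnerProductSpace.HarmonicOnNhd.eq_of_eventually_eq {u : ℂ → ℝ} {Ω : Set ℂ}
    (hu : InnerProductSpace.HarmonicOnNhd u Ω) (hΩ : IsPreconnected Ω) {z : ℂ} (hz : z ∈ Ω)
    (h : ∀ᶠ w in 𝓝 z, u w = u z) : ∀ w ∈ Ω, u w = u z :=
  AnalyticOnNhd.eqOn_of_preconnected_of_eventuallyEq (𝕜 := ℝ) (fun x hx => HarmonicAt.analyticAt (hu x hx))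
    (fun _ _ => analyticAt_const) hΩ hz h

/-- Near a critical point a harmonic function that is not locally constant takes, on at least four
consecutive rays, values alternately above and below its value at the point. -/
theorem InnerProductSpace.HarmonicAt.exists_alternating_rays {u : ℂ → ℝ} {z : ℂ}
    (h : InnerProductSpace.HarmonicAt u z) (hgrad : gradient u z = 0)
    (hne : ¬ ∀ᶠ w in 𝓝 z, u w = u z) :
    ∃ (n : ℕ) (α : ℝ), 2 ≤ n ∧ ∀ᶠ r : ℝ in 𝓝[>] 0, ∀ j : ℕ,
      0 < (-1) ^ j * (u (z + r * Complex.exp ((α + j * Real.pi / n : ℝ) * Complex.I)) - u z) := by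
  obtain ⟨F, hF, hFu⟩ := h.exists_analyticAt_re_eventuallyEq
  have hFa : AnalyticAt ℂ (fun w => F w - F z) z := hF.sub analyticAt_const
  have hFne : ¬ ∀ᶠ w in 𝓝 z, F w - F z = 0 := fun hc => hne (by
    filter_upwards [hc, hFu] with w hw hw'
    rw [hw', hFu.self_of_nhds, sub_eq_zero.1 hw])
  obtain ⟨n, g, hg, hgz, hfac⟩ := hFa.exists_eventuallyEq_pow_smul_nonzero_iff.2 hFne
  have hderiv : deriv F z = 0 := by
    have hf : fderiv ℝ u z = 0 := by
      have := hgrad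
      rwa [gradient, map_eq_zero_iff _ (LinearIsometryEquiv.injective _)] at this
    have hF' : HasFDerivAt u (Complex.reCLM.comp
        ((ContinuousLinearMap.toSpanSingleton ℂ (deriv F z)).restrictScalars ℝ)) z := by
      have h1 : HasFDerivAt F
          ((ContinuousLinearMap.toSpanSingleton ℂ (deriv F z)).restrictScalars ℝ) z :=
        (hF.differentiableAt.hasDerivAt.hasFDerivAt).restrictScalars ℝ
      exact (Complex.reCLM.hasFDerivAt.comp z h1).congr_of_eventuallyEq hFu
    rw [hF'.fderiv] at hf
    have e1 := DFunLike.congr_fun hf 1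
    have e2 := DFunLike.congr_fun hf Complex.I
    simp at e1 e2
    exact Complex.ext e1 e2
  have hn0 : n ≠ 0 := by
    rintro rfl
    have := hfac.self_of_nhds
    simp at this
    exact hgz this.symm
  have hn1 : n ≠ 1 := by
    rintro rfl
    have h1 : HasDerivAt (fun w => (w - z) ^ 1 • g w) (g z) z := by
      have := ((hasDerivAt_id z).sub_const z).mul hg.differentiableAt.hasDerivAt
      simp only [id, sub_self, zero_mul, one_mul, add_zero] at this
      simp only [pow_one, smul_eq_mul]
      exact this
    have h2 : HasDerivAt (fun w => F w - F z) (g z) z := h1.congr_of_eventuallyEq hfac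
    have h3 := (hF.differentiableAt.hasDerivAt.sub_const (F z)).unique h2
    exact hgz (h3 ▸ hderiv)
  have hpos : ∀ᶠ w in 𝓝 z, 0 < (g w / g z).re := by
    have hc : ContinuousAt (fun w => (g w / g z).re) z :=
      Complex.continuous_re.continuousAt.comp (hg.continuousAt.div_const _)
    exact hc.eventually (lt_mem_nhds (by simp [div_self hgz]))
  -- This angle cancels the argument of `g z`, so the leading term on ray `j` is real with sign
  -- `(-1) ^ j`.
  refine ⟨n, -(g z).arg / n, by omega, ?_⟩
  obtain ⟨ε, hε, hball⟩ := Metric.eventually_nhds_iff_ball.1 (hpos.and (hfac.and hFu))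
  filter_upwards [Ioo_mem_nhdsGT hε] with r hr j
  set θ : ℝ := -(g z).arg / n + j * Real.pi / n with hθ
  have hw : z + r * Complex.exp (θ * Complex.I) ∈ Metric.ball z ε := by
    simp [abs_of_pos hr.1, Complex.norm_exp_ofReal_mul_I, hr.2]
  obtain ⟨p, q, s⟩ := hball _ hw
  set w := z + r * Complex.exp (θ * Complex.I) with hwdef
  have hn : (n : ℂ) ≠ 0 := by exact_mod_cast hn0
  have hexp : Complex.exp (θ * Complex.I) ^ n * g z = (((-1) ^ j * ‖g z‖ : ℝ) : ℂ) := by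
    rw [← Complex.exp_nat_mul]
    have e : (n : ℂ) * (θ * Complex.I) = j * (Real.pi * Complex.I) + -((g z).arg * Complex.I) := by
      rw [hθ]; push_cast; field_simp; ring
    rw [e, Complex.exp_add, Complex.exp_nat_mul, Complex.exp_pi_mul_I]
    nth_rewrite 2 [← Complex.norm_mul_exp_arg_mul_I (g z)]
    have : Complex.exp (-((g z).arg * Complex.I)) * Complex.exp ((g z).arg * Complex.I) = 1 := by
      rw [← Complex.exp_add]; simp
    push_cast
    linear_combination (-1) ^ j * (‖g z‖ : ℂ) * this
  have hdiff : F w - F z = ((r ^ n * ((-1) ^ j * ‖g z‖) : ℝ) : ℂ) * (g w / g z) := by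
    rw [q, Complex.ofReal_mul, ← hexp, hwdef]
    simp only [add_sub_cancel_left, smul_eq_mul, mul_pow]
    push_cast
    field_simp
  have hre : u w - u z = r ^ n * ((-1) ^ j * ‖g z‖) * (g w / g z).re := by
    rw [s, hFu.self_of_nhds, ← Complex.sub_re, hdiff, Complex.re_ofReal_mul]
  have hsq : ((-1 : ℝ) ^ j) * (-1) ^ j = 1 := by
    rw [← mul_pow]; simp
  rw [hre]
  have : (-1 : ℝ) ^ j * (r ^ n * ((-1) ^ j * ‖g z‖) * (g w / g z).re) =
      r ^ n * ‖g z‖ * (g w / g z).re := by linear_combination r ^ n * ‖g z‖ * (g w / g z).re * hsq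
  rw [this]
  have := hr.1
  have := norm_pos_iff.2 hgz
  positivity

/-! ### Level sets on the closure and the conclusion -/

theorem boundaryMaxSet_eq {Ω : Set ℂ} (hΩ_open : IsOpen Ω) (hΩ : IsPreconnected Ω) {u : ℂ → ℝ}
    (hu : InnerProductSpace.HarmonicOnNhd u Ω) (hne : ∃ z ∈ Ω, ∃ w ∈ Ω, u z ≠ u w) :
    boundaryMaxSet Ω u = {z | z ∈ closure Ω ∧ IsLocalMaxOn u (closure Ω) z} := by
  ext z
  refine ⟨fun h => ⟨frontier_subset_closure h.1, h.2⟩, fun h => ⟨?_, h.2⟩⟩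
  rw [hΩ_open.frontier_eq]
  refine ⟨h.1, fun hz => ?_⟩
  have hc := hu.eq_of_eventually_eq hΩ hz ((hu z hz).eventually_eq_of_isLocalMax
    (h.2.isLocalMax (mem_of_superset (hΩ_open.mem_nhds hz) subset_closure)))
  obtain ⟨a, ha, b, hb, hab⟩ := hne
  exact hab ((hc a ha).trans (hc b hb).symm)

theorem isPreconnected_superlevel_closure {Ω : Set ℂ} (hΩ_open : IsOpen Ω)
    (hΩ : IsPreconnected Ω) (hΩ_bdd : Bornology.IsBounded Ω) {u : ℂ → ℝ}
    (hu : InnerProductSpace.HarmonicContOnCl u Ω) (hne : ∃ z ∈ Ω, ∃ w ∈ Ω, u z ≠ u w)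
    (hmax : IsPreconnected (boundaryMaxSet Ω u)) (c : ℝ) :
    IsPreconnected {x | x ∈ closure Ω ∧ c ≤ u x} := by
  rw [boundaryMaxSet_eq hΩ_open hΩ hu.harmonicOnNhd hne] at hmax
  exact isPreconnected_superlevel_of_isPreconnected_isLocalMaxOn hΩ_bdd.isCompact_closure
    hu.continuousOn hmax c

theorem boundaryMinSet_eq_boundaryMaxSet_neg (Ω : Set ℂ) (u : ℂ → ℝ) :
    boundaryMinSet Ω u = boundaryMaxSet Ω (-u) := by
  ext z
  simp [boundaryMinSet, boundaryMaxSet, IsLocalMinOn, IsLocalMaxOn, IsMinFilter, IsMaxFilter]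

theorem theorem3 (Ω : Set ℂ) (hΩ_open : IsOpen Ω) (hΩ_conn : IsConnected Ω)
    (hΩ_bdd : Bornology.IsBounded Ω)
    (u : ℂ → ℝ) (hu : InnerProductSpace.HarmonicContOnCl u Ω)
    (hu_nonconst : ∃ z ∈ Ω, ∃ w ∈ Ω, u z ≠ u w)
    (hmax : numComponents (boundaryMaxSet Ω u) = 1)
    (hmin : numComponents (boundaryMinSet Ω u) = 1) :
    criticalSet Ω u = ∅ := by
  have hsup := isPreconnected_superlevel_closure hΩ_open hΩ_conn.isPreconnected hΩ_bdd hu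
    hu_nonconst (isPreconnected_of_numComponents_eq_one hmax)
  have hsub := isPreconnected_superlevel_closure hΩ_open hΩ_conn.isPreconnected hΩ_bdd hu.neg
    (by simpa using hu_nonconst)
    (boundaryMinSet_eq_boundaryMaxSet_neg Ω u ▸ isPreconnected_of_numComponents_eq_one hmin)
  refine eq_empty_of_forall_notMem ?_
  rintro z ⟨hzΩ, hz⟩
  have hnc : ¬ ∀ᶠ w in 𝓝 z, u w = u z := fun hc => by
    have hc := hu.harmonicOnNhd.eq_of_eventually_eq hΩ_conn.isPreconnected hzΩ hc
    obtain ⟨a, ha, b, hb, hab⟩ := hu_nonconst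
    exact hab ((hc a ha).trans (hc b hb).symm)
  obtain ⟨n, α, hn, hr⟩ := (hu.harmonicOnNhd z hzΩ).exists_alternating_rays hz hnc
  obtain ⟨r₁, hr₁, hsign⟩ := mem_nhdsGT_iff_exists_Ioc_subset.1 hr
  obtain ⟨r₂, hr₂, hball⟩ := Metric.isOpen_iff.1 hΩ_open z hzΩ
  set r := min r₁ (r₂ / 2)
  have hr0 : 0 < r := lt_min hr₁ (half_pos hr₂)
  set β : ℕ → ℝ := fun j => α + j * Real.pi / n with hβ
  set x : ℕ → ℝ → ℂ := fun j t => z + t * Complex.exp (β j * Complex.I) with hx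
  have hxs : ∀ j t, 0 < t → t ≤ r → 0 < (-1) ^ j * (u (x j t) - u z) := fun j t h0 h1 =>
    hsign ⟨h0, h1.trans (min_le_left _ _)⟩ j
  have hxpos : ∀ j t, Even j → 0 ≤ t → t ≤ r → u z ≤ u (x j t) := by
    intro j t hj h0 h1
    rcases h0.eq_or_lt with rfl | h0
    · simp [hx]
    · have := hxs j t h0 h1
      rw [hj.neg_one_pow] at this; linarith
  have hxneg : ∀ j t, Odd j → 0 ≤ t → t ≤ r → u (x j t) ≤ u z := by
    intro j t hj h0 h1
    rcases h0.eq_or_lt with rfl | h0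
    · simp [hx]
    · have := hxs j t h0 h1
      rw [hj.neg_one_pow] at this; linarith
  have hxΩ : ∀ j, x j r ∈ closure Ω := fun j => subset_closure (hball (by
    have : r < r₂ := (min_le_right _ _).trans_lt (half_lt_self hr₂)
    simp [hx, abs_of_pos hr0, Complex.norm_exp_ofReal_mul_I, this]))
  -- A positive gap `ε` makes the two level sets disjoint and keeps each off the opposite radii,
  -- including `z`.
  have hev : ∀ᶠ ε in 𝓝[>] (0 : ℝ), ∀ j < 4, ε ≤ (-1) ^ j * (u (x j r) - u z) := by
    refine (eventually_all_finite (finite_lt_nat 4)).2 ?_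
    exact fun j _ => (eventually_le_nhds (hxs j r hr0 le_rfl)).filter_mono nhdsWithin_le_nhds
  obtain ⟨ε, hεx, hε⟩ := (hev.and self_mem_nhdsWithin).exists
  have h0 : u z + ε ≤ u (x 0 r) := by linarith [hεx 0 (by norm_num)]
  have h1 : u (x 1 r) ≤ u z - ε := by linarith [hεx 1 (by norm_num)]
  have h2 : u z + ε ≤ u (x 2 r) := by linarith [hεx 2 (by norm_num)]
  have h3 : u (x 3 r) ≤ u z - ε := by linarith [hεx 3 (by norm_num)]
  have hcpt : IsCompact {y | y ∈ closure Ω ∧ u z + ε ≤ u y} :=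
    hΩ_bdd.isCompact_closure.of_isClosed_subset
      (hu.continuousOn.preimage_isClosed_of_isClosed isClosed_closure isClosed_Ici)
      fun y hy => hy.1
  have hN : ∀ y, u y ≤ u z - ε → -(u z - ε) ≤ (-u) y := fun y hy => neg_le_neg hy
  have hN' : ∀ y, -(u z - ε) ≤ (-u) y → u y ≤ u z - ε := fun y hy => neg_le_neg_iff.1 hy
  have hn' : (0 : ℝ) < n := by positivity
  have hstep : ∀ j, β j < β (j + 1) := fun j => by
    simp only [hβ]; push_cast
    gcongr; linarith
  refine not_interlaced_of_disjoint_of_isPreconnected hcpt (hsup (u z + ε)) (hsub (-(u z - ε)))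
    (disjoint_left.2 fun y hy hy' => by linarith [hy.2, hN' y hy'.2]) hr0
    (hstep 0) (hstep 1) (hstep 2) ?_ ⟨hxΩ 0, h0⟩ ⟨hxΩ 2, h2⟩ ⟨hxΩ 1, hN _ h1⟩ ⟨hxΩ 3, hN _ h3⟩
    (fun t ht0 ht1 h => by linarith [hN' _ h.2, hxpos 0 t (by decide) ht0 ht1])
    (fun t ht0 ht1 h => by linarith [hN' _ h.2, hxpos 2 t (by decide) ht0 ht1])
    (fun t ht0 ht1 h => by linarith [h.2, hxneg 1 t (by decide) ht0 ht1])
    (fun t ht0 ht1 h => by linarith [h.2, hxneg 3 t (by decide) ht0 ht1])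
  have h2n : (2 : ℝ) ≤ n := by exact_mod_cast hn
  simp only [hβ]
  push_cast
  -- As `n ≥ 2`, the four rays fit within one turn.
  have : 3 * Real.pi / n < 2 * Real.pi := by
    rw [div_lt_iff₀ hn']; nlinarith [Real.pi_pos]
  simp only [zero_mul, zero_div, add_zero]
  linarith
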